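/- Consider the position-based click model with $K$ items and $L\le K$ positions. Its parameter is $\theta=(\theta_1,\dots,\theta_K)\in\Theta=(0,1)^K$, and the examination probabilities $1\ge\kappa_1>\dots>\kappa_L>0$ are fixed and known. An action is an ordered list $a=(a_1,\dots,a_L)$ of $L$ distinct items; $\mathcal A$ is the set of actions. In each round $t=1,2,\dots$ the algorithm chooses an action $A(t)$, possibly at random, on the basis of the past actions and observations, and observes $Z(t)=(X_1(t)Y_1(t),\dots,X_L(t)Y_L(t))$, where, given the past and $A(t)$, the variables $X_l(t)\sim\mathcal B(\theta_{A_l(t)})$ and $Y_l(t)\sim\mathcal B(\kappa_l)$ ($1\le l\le L$) are independent Bernoulli variables. The reward of the round is $r_{A(t)}=\sum_{l=1}^L Z_l(t)$. Put $\mu_a(\theta)=\sum_{l=1}^L\kappa_l\theta_{a_l}$, $\mu^*(\theta)=\max_{a\in\mathcal A}\mu_a(\theta)$, $\Delta_a(\theta)=\mu^*(\theta)-\mu_a(\theta)$, and let $$\mathbb E_\theta[R(T)]=\mathbb E_\theta\Big[\sum_{t=1}^T\big(\mu^*(\theta)-r_{A(t)}\big)\Big]$$ be the expected regret after $T$ rounds.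 The algorithm is called uniformly efficient if $\mathbb E_\theta[R(T)]=o(T^\alpha)$ as $T\to\infty$ for every $\theta\in\Theta$ and every $\alpha\in(0,1]$. For $\theta,\lambda\in\Theta$ let $I_l(\theta_k,\lambda_k)$ be the expected log-likelihood ratio, under $\theta$ and relative to $\lambda$, of the observation at position $l$ when item $k$ is displayed there, that is, the Kullback–Leibler divergence from the Bernoulli law with mean $\kappa_l\theta_k$ to the one with mean $\kappa_l\lambda_k$. Put $I_a(\theta,\lambda)=\sum_{l=1}^L I_l(\theta_{a_l},\lambda_{a_l})$ and $$B(\theta)=\{\lambda\in\Theta:\ \lambda_l=\theta_l\text{ for all }l\le L,\ \text{and}\ \mu^*(\theta)<\mu^*(\lambda)\}.$$ **Theorem.** Let $\theta\in\Theta$ satisfy $\theta_1>\dots>\theta_L$ and $\theta_L>\theta_k$ for all $k>L$, so that the optimal action is $(1,\dots,L)$. Then every uniformly efficient algorithm satisfies $$\liminf_{T\to\infty}\frac{\mathbb E_\theta[R(T)]}{\log T}\ \ge\ f(\theta),$$ where $$f(\theta)=\inf_{c\succeq 0}\ \sum_{a\in\mathcal A}\Delta_a(\theta)\,c_a\quad\text{subject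 to}\quad \inf_{\lambda\in B(\theta)}\ \sum_{a\in\mathcal A}I_a(\theta,\lambda)\,c_a\ \ge\ 1,$$ the infimum being over the vectors $c=(c_a)_{a\in\mathcal A}$ of non-negative real numbers (and an infimum over the empty set being $+\infty$). -/

import Mathlib

open Filter Asymptotics

noncomputable section

namespace PBM

/-- The parameter space `Θ = (0,1)^K` of the vectors of arm expectations. -/
abbrev Param (K : ℕ) : Type := Fin K → Set.Ioo (0 : ℝ) 1

/-- Actions: ordered lists of `L` distinct arms among `K` (arms and positions are numbered
from `0`). -/
abbrev Action (K L : ℕ) : Type := Fin L ↪ Fin K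

/-- The feedback of one round: for each position, whether a click was observed. -/
abbrev Feedback (L : ℕ) : Type := Fin L → Bool

/-- What the learner sees in the first `t` rounds: the actions and the censored feedback. -/
abbrev History (K L t : ℕ) : Type := Fin t → Action K L × Feedback L

/-- The number in `{0, 1}` that a Boolean stands for. -/
def ind (b : Bool) : ℝ := if b then 1 else 0

/-- The Bernoulli distribution with parameter `p`. -/
def bern (p : unitInterval) : PMF Bool :=
  PMF.ofFintype (fun b => if b then ENNReal.ofReal (p : ℝ) else ENNReal.ofReal (1 - (p : ℝ))) (by
    have h : (0 : ℝ) ≤ 1 - (p : ℝ) := by linarith [p.2.2]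
    rw [Fintype.sum_bool]
    simp [← ENNReal.ofReal_add p.2.1 h])

/-- The joint distribution of independent discrete random variables with the given marginals. -/
def indep {ι β : Type} [Fintype ι] [DecidableEq ι] [Fintype β] (p : ι → PMF β) : PMF (ι → β) :=
  PMF.ofFintype (fun w => ∏ i, p i (w i)) (by
    rw [← Fintype.prod_sum (fun i b => p i b)]
    refine Finset.prod_eq_one fun i _ => ?_
    rw [← tsum_fintype (L := SummationFilter.unconditional _)]
    exact (p i).tsum_coe)

/-- A parameter in `(0,1)` as a probability. -/
def toProb (p : Set.Ioo (0 : ℝ) 1) : unitInterval := ⟨(p : ℝ), p.2.1.le, p.2.2.le⟩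

/-- The distribution of the censored observation `Z = X Y` with independent `X ∼ B(p)` (the
evaluation of the item) and `Y ∼ B(κ)` (the examination of the position). -/
def censored (κ : unitInterval) (p : Set.Ioo (0 : ℝ) 1) : PMF Bool :=
  (bern (toProb p)).bind fun x => (bern κ).map fun y => x && y

/-- The distribution of the feedback `(Z_1, …, Z_L)` when the action `a` is played. -/
def feedbackLaw {K L : ℕ} (κ : Fin L → unitInterval) (θ : Param K) (a : Action K L) :
    PMF (Feedback L) :=
  indep fun l => censored (κ l) (θ (a l))

/-- An algorithm chooses its next action, possibly at random, from the past actions and the past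
observations. -/
abbrev Algorithm (K L : ℕ) : Type := (t : ℕ) → History K L t → PMF (Action K L)

/-- The distribution of the history of the first `t` rounds when the algorithm `π` faces the
model with parameter `θ`. -/
def historyLaw {K L : ℕ} (κ : Fin L → unitInterval) (π : Algorithm K L) (θ : Param K) :
    (t : ℕ) → PMF (History K L t)
  | 0 => PMF.pure Fin.elim0
  | t + 1 => (historyLaw κ π θ t).bind fun h => (π t h).bind fun a =>
      (feedbackLaw κ θ a).map fun z => Fin.snoc (α := fun _ => Action K L × Feedback L) h (a, z)

/-- The expectation of a function on a finite probability space. -/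
def expect {α : Type} [Fintype α] (p : PMF α) (f : α → ℝ) : ℝ := ∑ x, (p x).toReal * f x

/-- The expected reward `μ_a(θ)` of the action `a`. -/
def mean {K L : ℕ} (κ : Fin L → unitInterval) (θ : Param K) (a : Action K L) : ℝ :=
  ∑ l, (κ l : ℝ) * (θ (a l) : ℝ)

/-- The best expected reward `μ^*(θ)`. -/
def bestMean {K L : ℕ} (κ : Fin L → unitInterval) (θ : Param K) : ℝ :=
  ⨆ a : Action K L, mean κ θ a

/-- The gap `Δ_a(θ)` of the action `a`. -/
def gap {K L : ℕ} (κ : Fin L → unitInterval) (θ : Param K) (a : Action K L) : ℝ :=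
  bestMean κ θ - mean κ θ a

/-- The reward of one round: the number of observed clicks. -/
def reward {L : ℕ} (z : Feedback L) : ℝ := ∑ l, ind (z l)

/-- The expected regret after `T` rounds. -/
def expectedRegret {K L : ℕ} (κ : Fin L → unitInterval) (π : Algorithm K L) (θ : Param K)
    (T : ℕ) : ℝ :=
  expect (historyLaw κ π θ T) fun h => ∑ s, (bestMean κ θ - reward (h s).2)

/-- Uniformly efficient algorithms: for every parameter the expected regret is `o(T^α)` for all
`α ∈ (0,1]`. -/
def UniformlyEfficient {K L : ℕ} (κ : Fin L → unitInterval) (π : Algorithm K L) : Prop :=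
  ∀ θ : Param K, ∀ α : ℝ, 0 < α → α ≤ 1 →
    (fun T : ℕ => expectedRegret κ π θ T) =o[atTop] fun T : ℕ => (T : ℝ) ^ α

/-- The information `I_l(p, q)`: the expected log-likelihood ratio of an observation at a position
with examination probability `κ`, of an item whose parameter is `p` against `q`. -/
def localInfo (κ : unitInterval) (p q : Set.Ioo (0 : ℝ) 1) : ℝ :=
  expect (censored κ p) fun z =>
    Real.log ((censored κ p z).toReal / (censored κ q z).toReal)

/-- The information `I_a(θ, λ)` of the action `a`. -/
def info {K L : ℕ} (κ : Fin L → unitInterval) (θ lam : Param K) (a : Action K L) : ℝ :=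
  ∑ l, ∑ k, if a l = k then localInfo (κ l) (θ k) (lam k) else 0

/-- The set `B(θ)` of the parameters that agree with `θ` on the first `L` arms and have a strictly
larger best expected reward. -/
def confusing {K L : ℕ} (κ : Fin L → unitInterval) (θ : Param K) : Set (Param K) :=
  {lam | (∀ k : Fin K, (k : ℕ) < L → lam k = θ k) ∧ bestMean κ θ < bestMean κ lam}

/-- The vectors `c ⪰ 0` with `inf_{λ ∈ B(θ)} ∑_a I_a(θ, λ) c_a ≥ 1`. -/
def feasible {K L : ℕ} (κ : Fin L → unitInterval) (θ : Param K) : Set (Action K L → ℝ) :=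
  {c | (∀ a, 0 ≤ c a) ∧
    (1 : EReal) ≤ ⨅ lam ∈ confusing κ θ, ((∑ a, info κ θ lam a * c a : ℝ) : EReal)}

/-- The value `f(θ)` of the optimisation problem. -/
def lowerBound {K L : ℕ} (κ : Fin L → unitInterval) (θ : Param K) : EReal :=
  ⨅ c ∈ feasible κ θ, ((∑ a, gap κ θ a * c a : ℝ) : EReal)

end PBM

end

/-!
The proof follows the change-of-measure argument of Graves and Lai. Write `N_a(T)` for the number
of plays of the action `a` in `T` rounds and `a*` for the list of the first `L` items, which is the
unique optimal action under `θ` (`gap_pos`). By Wald's identity (`expect_sum_rounds`), the expected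
regret is `∑ a, Δ_a(θ) E_θ[N_a(T)]` (`expectedRegret_eq`), and the expected log-likelihood ratio of
the first `T` rounds against another parameter `λ` is `∑ a, I_a(θ, λ) E_θ[N_a(T)]`.

Let `λ ∈ B(θ)`. It agrees with `θ` on the items of `a*`, so `a*` keeps its mean, but is suboptimal
under `λ`. A uniformly efficient algorithm thus plays `a*` in almost all rounds under `θ`, and only
`o(T ^ α)` times under `λ`. The variational inequality `E_θ[g] ≤ KL + E_λ[exp g] - 1`
(`expect_le_info_add`), applied to `g = y log T · N_{a*}(T) / T` with `y < 1`, turns this into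
`∑ a, I_a(θ, λ) E_θ[N_a(T)] ≥ (y - o(1)) log T` (`UniformlyEfficient.eventually_le_info`).

If the limit inferior of `E_θ[R(T)] / log T` were less than some `M < f(θ)`, then along some
ultrafilter the ratios `E_θ[N_a(T)] / log T` with `a ≠ a*` would be bounded by `M / Δ_a(θ)` and
hence converge. As `Δ_{a*}(θ) = I_{a*}(θ, λ) = 0`, the limits, completed by `0` at `a*`, form a
feasible vector whose value is at most `M`, a contradiction.
-/

noncomputable section

namespace PBM

/-! ### Expectations on finite probability spaces -/

section Expect

variable {α β : Type} [Fintype α] [Fintype β]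

lemma sum_toReal (p : PMF α) : ∑ x, (p x).toReal = 1 := by
  rw [← ENNReal.toReal_sum fun x _ => p.apply_ne_top x,
    ← tsum_fintype (L := SummationFilter.unconditional _), p.tsum_coe, ENNReal.toReal_one]

lemma expect_const (p : PMF α) (c : ℝ) : expect p (fun _ => c) = c := by
  rw [expect, ← Finset.sum_mul, sum_toReal, one_mul]

lemma expect_add (p : PMF α) (f g : α → ℝ) :
    expect p (fun x => f x + g x) = expect p f + expect p g := by
  simp only [expect, mul_add, Finset.sum_add_distrib]

lemma expect_sub (p : PMF α) (f g : α → ℝ) :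
    expect p (fun x => f x - g x) = expect p f - expect p g := by
  simp only [expect, mul_sub, Finset.sum_sub_distrib]

lemma expect_const_mul (p : PMF α) (c : ℝ) (f : α → ℝ) :
    expect p (fun x => c * f x) = c * expect p f := by
  simp only [expect, Finset.mul_sum]
  exact Finset.sum_congr rfl fun x _ => by ring

lemma expect_sum {ι : Type*} (s : Finset ι) (p : PMF α) (f : ι → α → ℝ) :
    expect p (fun x => ∑ i ∈ s, f i x) = ∑ i ∈ s, expect p (f i) := by
  simp only [expect, Finset.mul_sum]
  exact Finset.sum_comm

lemma expect_mono (p : PMF α) {f g : α → ℝ} (h : ∀ x, f x ≤ g x) : expect p f ≤ expect p g :=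
  Finset.sum_le_sum fun x _ => mul_le_mul_of_nonneg_left (h x) ENNReal.toReal_nonneg

lemma expect_bind (p : PMF α) (k : α → PMF β) (g : β → ℝ) :
    expect (p.bind k) g = expect p fun x => expect (k x) g := by
  have h (y : β) : (p.bind k y).toReal = ∑ x, (p x).toReal * (k x y).toReal := by
    rw [PMF.bind_apply, tsum_fintype, ENNReal.toReal_sum fun x _ =>
      ENNReal.mul_ne_top (p.apply_ne_top x) ((k x).apply_ne_top y)]
    simp only [ENNReal.toReal_mul]
  simp only [expect, h, Finset.sum_mul, Finset.mul_sum]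
  rw [Finset.sum_comm]
  exact Finset.sum_congr rfl fun x _ => Finset.sum_congr rfl fun y _ => by ring

lemma expect_pure (a : α) (g : α → ℝ) : expect (PMF.pure a) g = g a := by
  classical
  rw [expect, Finset.sum_eq_single a] <;> simp +contextual [PMF.pure_apply]

lemma expect_map (p : PMF α) (f : α → β) (g : β → ℝ) :
    expect (p.map f) g = expect p fun x => g (f x) := by
  simp only [PMF.map, expect_bind, Function.comp_apply, expect_pure]

lemma toReal_indep {ι : Type} [Fintype ι] [DecidableEq ι] (p : ι → PMF β) (w : ι → β) :
    (indep p w).toReal = ∏ i, (p i (w i)).toReal := by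
  simp [indep, PMF.ofFintype_apply, ENNReal.toReal_prod]

/-- The marginals of `indep p` are the given laws. -/
lemma expect_indep_apply {ι : Type} [Fintype ι] [DecidableEq ι] (p : ι → PMF β) (i : ι)
    (f : β → ℝ) : expect (indep p) (fun w => f (w i)) = expect (p i) f := by
  have h (w : ι → β) : (indep p w).toReal * f (w i)
      = ∏ j, (p j (w j)).toReal * (if j = i then f (w j) else 1) := by
    rw [toReal_indep, Finset.prod_mul_distrib]
    simp
  simp only [expect, h]
  rw [← Fintype.prod_sum (fun j b => (p j b).toReal * (if j = i then f b else 1)),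
    Finset.prod_eq_single i]
  · simp
  · intro j _ hj
    simp [hj, sum_toReal]
  · simp

end Expect

/-! ### The law of a single observation -/

lemma expect_bern (p : unitInterval) (f : Bool → ℝ) :
    expect (bern p) f = p * f true + (1 - p) * f false := by
  have h : 0 ≤ 1 - (p : ℝ) := sub_nonneg.2 p.2.2
  rw [expect, Fintype.sum_bool]
  simp only [bern, PMF.ofFintype_apply, if_true, ENNReal.toReal_ofReal p.2.1, Bool.false_eq_true,
    if_false, ENNReal.toReal_ofReal h]

lemma toReal_censored_true (κ : unitInterval) (p : Set.Ioo (0 : ℝ) 1) :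
    (censored κ p true).toReal = κ * p := by
  have h : expect (censored κ p) ind = κ * p := by
    simp [censored, expect_bind, expect_map, expect_bern, ind, toProb, mul_comm]
  simpa [expect, ind] using h

lemma toReal_censored_false (κ : unitInterval) (p : Set.Ioo (0 : ℝ) 1) :
    (censored κ p false).toReal = 1 - κ * p := by
  have h := sum_toReal (censored κ p)
  rw [Fintype.sum_bool, toReal_censored_true] at h
  linarith

lemma toReal_censored_pos {κ : unitInterval} (hκ : 0 < κ) (p : Set.Ioo (0 : ℝ) 1) (z : Bool) :
    0 < (censored κ p z).toReal := by
  have h0 : (0 : ℝ) < κ := hκ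
  cases z
  · rw [toReal_censored_false]
    have : (κ : ℝ) * p < 1 := by nlinarith [κ.2.2, p.2.1, p.2.2]
    linarith
  · rw [toReal_censored_true]
    exact mul_pos h0 p.2.1

variable {K L : ℕ}

lemma expect_reward (κ : Fin L → unitInterval) (θ : Param K) (a : Action K L) :
    expect (feedbackLaw κ θ a) reward = mean κ θ a := by
  unfold reward feedbackLaw mean
  rw [expect_sum Finset.univ _ fun l (z : Feedback L) => ind (z l)]
  refine Finset.sum_congr rfl fun l _ => ?_
  rw [expect_indep_apply (fun l => censored (κ l) (θ (a l))) l ind]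
  simp [expect, ind, toReal_censored_true]

/-- The log-likelihood ratio of `θ` against `lam` of the outcome `x` of one round. -/
def logRatio (κ : Fin L → unitInterval) (θ lam : Param K) (x : Action K L × Feedback L) : ℝ :=
  ∑ l, Real.log ((censored (κ l) (θ (x.1 l)) (x.2 l)).toReal /
    (censored (κ l) (lam (x.1 l)) (x.2 l)).toReal)

lemma expect_logRatio (κ : Fin L → unitInterval) (θ lam : Param K) (a : Action K L) :
    expect (feedbackLaw κ θ a) (fun z => logRatio κ θ lam (a, z)) = info κ θ lam a := by
  unfold logRatio feedbackLaw info
  rw [expect_sum]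
  refine Finset.sum_congr rfl fun l _ => ?_
  rw [expect_indep_apply (fun l => censored (κ l) (θ (a l))) l fun z =>
    Real.log ((censored (κ l) (θ (a l)) z).toReal / (censored (κ l) (lam (a l)) z).toReal)]
  simp [localInfo]

/-- Weighting by the inverse likelihood ratio of a round turns the feedback law of `θ` into that of
`lam`; `κ l > 0` keeps all likelihoods positive. -/
lemma expect_feedbackLaw_exp_neg {κ : Fin L → unitInterval} (hκ : ∀ l, 0 < κ l)
    (θ lam : Param K) (a : Action K L) (g : Feedback L → ℝ) :
    expect (feedbackLaw κ θ a) (fun z => g z * Real.exp (-logRatio κ θ lam (a, z)))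
      = expect (feedbackLaw κ lam a) g := by
  refine Finset.sum_congr rfl fun z _ => ?_
  have h : Real.exp (-logRatio κ θ lam (a, z)) = ∏ l,
      ((censored (κ l) (lam (a l)) (z l)).toReal / (censored (κ l) (θ (a l)) (z l)).toReal) := by
    rw [logRatio, ← Finset.sum_neg_distrib, Real.exp_sum]
    refine Finset.prod_congr rfl fun l _ => ?_
    rw [← Real.log_inv, inv_div, Real.exp_log]
    exact div_pos (toReal_censored_pos (hκ l) _ _) (toReal_censored_pos (hκ l) _ _)
  beta_reduce
  rw [h, feedbackLaw, feedbackLaw, toReal_indep, toReal_indep, mul_left_comm,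
    ← Finset.prod_mul_distrib, mul_comm]
  congr 1
  refine Finset.prod_congr rfl fun l _ => ?_
  rw [mul_div_cancel₀ _ (toReal_censored_pos (hκ l) _ _).ne']

/-! ### Expected numbers of plays and the change of measure -/

/-- The number of rounds of the history `h` in which the action `a` is played. -/
def plays {t : ℕ} (h : History K L t) (a : Action K L) : ℝ := ∑ s, if (h s).1 = a then 1 else 0

/-- The expected number of plays of the action `a` in the first `t` rounds. -/
def expectedPlays (κ : Fin L → unitInterval) (π : Algorithm K L) (θ : Param K) (t : ℕ)
    (a : Action K L) : ℝ :=
  expect (historyLaw κ π θ t) fun h => plays h a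

section History

variable (κ : Fin L → unitInterval) (π : Algorithm K L) (θ : Param K)

lemma expect_historyLaw_succ (t : ℕ) (g : History K L (t + 1) → ℝ) :
    expect (historyLaw κ π θ (t + 1)) g = expect (historyLaw κ π θ t) fun h =>
      expect (π t h) fun a => expect (feedbackLaw κ θ a) fun z =>
        g (Fin.snoc (α := fun _ => Action K L × Feedback L) h (a, z)) := by
  rw [historyLaw]
  simp only [expect_bind, expect_map]

lemma sum_snoc {t : ℕ} (f : Action K L × Feedback L → ℝ) (h : History K L t)
    (x : Action K L × Feedback L) :
    ∑ s, f (Fin.snoc (α := fun _ => Action K L × Feedback L) h x s) = ∑ s, f (h s) + f x := by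
  simp [Fin.sum_univ_castSucc]

lemma expectedPlays_succ (t : ℕ) (a : Action K L) :
    expectedPlays κ π θ (t + 1) a = expectedPlays κ π θ t a
      + expect (historyLaw κ π θ t) fun h => (π t h a).toReal := by
  rw [expectedPlays, expect_historyLaw_succ, expectedPlays, ← expect_add]
  congr 1
  funext h
  simp only [plays]
  simp only [sum_snoc (fun x => if x.1 = a then (1 : ℝ) else 0), expect_const, expect_add]
  simp [expect, sum_toReal]

/-- Wald's identity: the feedback of each round has, given the past, a law that depends only on
the action played, so the expectation of a sum over the rounds is a combination of the expected
numbers of plays. -/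
lemma expect_sum_rounds (f : Action K L × Feedback L → ℝ) (t : ℕ) :
    expect (historyLaw κ π θ t) (fun h => ∑ s, f (h s))
      = ∑ a, expectedPlays κ π θ t a * expect (feedbackLaw κ θ a) fun z => f (a, z) := by
  induction t with
  | zero => simp [expectedPlays, plays, expect_const]
  | succ t ih =>
    rw [expect_historyLaw_succ]
    simp only [sum_snoc, expect_add, expect_const, expectedPlays_succ, add_mul,
      Finset.sum_add_distrib, ih]
    congr 1
    simp only [expect, Finset.sum_mul, Finset.mul_sum]
    rw [Finset.sum_comm]
    refine Finset.sum_congr rfl fun a _ => ?_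
    rw [Finset.sum_comm]
    exact Finset.sum_congr rfl fun z _ => Finset.sum_congr rfl fun h _ => by ring

lemma expectedRegret_eq (T : ℕ) :
    expectedRegret κ π θ T = ∑ a, gap κ θ a * expectedPlays κ π θ T a := by
  rw [expectedRegret, expect_sum_rounds κ π θ fun x => bestMean κ θ - reward x.2]
  refine Finset.sum_congr rfl fun a _ => ?_
  rw [expect_sub, expect_const, expect_reward, gap, mul_comm]

lemma sum_expectedPlays (T : ℕ) : ∑ a, expectedPlays κ π θ T a = T := by
  have h := expect_sum_rounds κ π θ (fun _ => 1) T
  simpa [expect_const] using h.symm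

lemma plays_nonneg {t : ℕ} (h : History K L t) (a : Action K L) : 0 ≤ plays h a :=
  Finset.sum_nonneg fun s _ => by split_ifs <;> norm_num

lemma plays_le {t : ℕ} (h : History K L t) (a : Action K L) : plays h a ≤ t := by
  have : plays h a ≤ ∑ _s : Fin t, (1 : ℝ) :=
    Finset.sum_le_sum fun s _ => by split_ifs <;> norm_num
  simpa using this

lemma expectedPlays_nonneg (t : ℕ) (a : Action K L) : 0 ≤ expectedPlays κ π θ t a := by
  rw [← expect_const (historyLaw κ π θ t) 0]
  exact expect_mono _ fun h => plays_nonneg h a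

variable {κ} in
/-- Change of measure for whole histories. The choices of the algorithm have the same conditional
law under both parameters, so only the feedback enters the likelihood ratio. -/
lemma expect_historyLaw_exp_neg (hκ : ∀ l, 0 < κ l) (lam : Param K) (t : ℕ)
    (g : History K L t → ℝ) :
    expect (historyLaw κ π θ t) (fun h => g h * Real.exp (-∑ s, logRatio κ θ lam (h s)))
      = expect (historyLaw κ π lam t) g := by
  induction t with
  | zero => simp [historyLaw]
  | succ t ih =>
    rw [expect_historyLaw_succ, expect_historyLaw_succ, ← ih]
    congr 1
    funext h
    simp only [sum_snoc, neg_add, Real.exp_add]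
    rw [mul_comm, ← expect_const_mul]
    congr 1
    funext a
    rw [← expect_feedbackLaw_exp_neg hκ θ lam a, ← expect_const_mul]
    congr 1
    funext z
    ring

variable {κ} in
/-- A weak form of the Donsker–Varadhan inequality for the laws of the history under `θ` and `lam`,
whose relative entropy is `∑ a, N_a I_a(θ, lam)` for the expected numbers of plays `N_a`. -/
lemma expect_le_info_add (hκ : ∀ l, 0 < κ l) (lam : Param K) (t : ℕ) (g : History K L t → ℝ) :
    expect (historyLaw κ π θ t) g ≤ ∑ a, info κ θ lam a * expectedPlays κ π θ t a
      + (expect (historyLaw κ π lam t) (fun h => Real.exp (g h)) - 1) := by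
  -- `x ≤ exp x - 1` at the difference of `g` and the log-likelihood ratio
  have h1 : expect (historyLaw κ π θ t) (fun h => g h - ∑ s, logRatio κ θ lam (h s))
      ≤ expect (historyLaw κ π θ t)
        (fun h => Real.exp (g h) * Real.exp (-∑ s, logRatio κ θ lam (h s)) - 1) := by
    refine expect_mono _ fun h => ?_
    rw [← Real.exp_add, ← sub_eq_add_neg]
    linarith [Real.add_one_le_exp (g h - ∑ s, logRatio κ θ lam (h s))]
  rw [expect_sub, expect_sub, expect_const, expect_historyLaw_exp_neg π θ hκ lam t,
    expect_sum_rounds] at h1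
  simp only [expect_logRatio] at h1
  have h2 : ∑ a, expectedPlays κ π θ t a * info κ θ lam a
      = ∑ a, info κ θ lam a * expectedPlays κ π θ t a :=
    Finset.sum_congr rfl fun a _ => mul_comm _ _
  linarith

variable {κ} in
/-- An action that is played often under `θ` and rarely under `lam` forces a large information. -/
lemma mul_expectedPlays_le_info_add (hκ : ∀ l, 0 < κ l) (lam : Param K) {T : ℕ} (hT : 0 < T)
    (a : Action K L) (x : ℝ) :
    x * (expectedPlays κ π θ T a / T) ≤ ∑ b, info κ θ lam b * expectedPlays κ π θ T b
      + Real.exp x * (expectedPlays κ π lam T a / T) := by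
  have hT' : (0 : ℝ) < T := by exact_mod_cast hT
  have h := expect_le_info_add π θ hκ lam T fun h => x / T * plays h a
  rw [expect_const_mul] at h
  -- convexity of `exp` on the segment from `0` to `x`
  have h2 : expect (historyLaw κ π lam T) (fun h => Real.exp (x / T * plays h a))
      ≤ expect (historyLaw κ π lam T) (fun h => 1 + Real.exp x / T * plays h a) := by
    refine expect_mono _ fun h => ?_
    have hu0 : 0 ≤ plays h a / T := div_nonneg (plays_nonneg h a) hT'.le
    have hu1 : plays h a / T ≤ 1 := (div_le_one hT').2 (plays_le h a)
    have := convexOn_exp.2 (Set.mem_univ 0) (Set.mem_univ x) (sub_nonneg.2 hu1) hu0 (by ring)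
    simp only [smul_eq_mul, mul_zero, zero_add, Real.exp_zero, mul_one] at this
    calc Real.exp (x / T * plays h a) = Real.exp (plays h a / T * x) := by congr 1; ring
      _ ≤ 1 - plays h a / T + plays h a / T * Real.exp x := this
      _ ≤ 1 + Real.exp x / T * plays h a := by
        rw [show Real.exp x / T * plays h a = plays h a / T * Real.exp x by ring]
        linarith
  rw [expect_add, expect_const, expect_const_mul] at h2
  change x / T * expectedPlays κ π θ T a ≤ _ at h
  change _ ≤ 1 + Real.exp x / T * expectedPlays κ π lam T a at h2
  calc x * (expectedPlays κ π θ T a / T) = x / T * expectedPlays κ π θ T a := by ring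
    _ ≤ _ := h
    _ ≤ ∑ b, info κ θ lam b * expectedPlays κ π θ T b
        + Real.exp x / T * expectedPlays κ π lam T a := by linarith
    _ = _ := by ring

end History

/-! ### Gaps and the optimal action -/

lemma mean_le_bestMean (κ : Fin L → unitInterval) (θ : Param K) (a : Action K L) :
    mean κ θ a ≤ bestMean κ θ :=
  le_ciSup (f := mean κ θ) (Set.finite_range _).bddAbove a

lemma gap_nonneg (κ : Fin L → unitInterval) (θ : Param K) (a : Action K L) : 0 ≤ gap κ θ a :=
  sub_nonneg.2 (mean_le_bestMean κ θ a)

lemma gap_mul_expectedPlays_le (κ : Fin L → unitInterval) (π : Algorithm K L) (θ : Param K)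
    (T : ℕ) (a : Action K L) : gap κ θ a * expectedPlays κ π θ T a ≤ expectedRegret κ π θ T := by
  rw [expectedRegret_eq]
  exact Finset.single_le_sum (f := fun a => gap κ θ a * expectedPlays κ π θ T a)
    (fun b _ => mul_nonneg (gap_nonneg κ θ b) (expectedPlays_nonneg κ π θ T b))
    (Finset.mem_univ a)

/-- The action that displays the first `L` items in their order. -/
def firstItems (hLK : L ≤ K) : Action K L := Fin.castLEEmb hLK

section Optimal

variable {κ : Fin L → unitInterval} {θ : Param K}

/-- Exchanging the first misplaced item for the one that belongs there increases the mean. -/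
lemma exists_mean_lt (hLK : L ≤ K) (hκ : StrictAnti κ) (hκ_pos : ∀ l, 0 < κ l)
    (hθ : ∀ i j : Fin K, i < j → (i : ℕ) < L → θ j < θ i) {a : Action K L}
    (ha : a ≠ firstItems hLK) : ∃ b : Action K L, mean κ θ a < mean κ θ b := by
  obtain ⟨l, hl, hmin⟩ : ∃ l, a l ≠ Fin.castLE hLK l ∧ ∀ m < l, a m = Fin.castLE hLK m := by
    have hne : ∃ l, a l ≠ Fin.castLE hLK l := by
      by_contra! h
      exact ha (Function.Embedding.ext h)
    obtain ⟨l, hl, hm⟩ := WellFounded.has_min (wellFounded_lt (α := Fin L))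
      {l | a l ≠ Fin.castLE hLK l} hne
    exact ⟨l, hl, fun m hml => by_contra fun h => hm m h hml⟩
  set i : Fin K := Fin.castLE hLK l with hi
  have hlt : i < a l := by
    by_contra! h
    have h' : a l < i := lt_of_le_of_ne h hl
    have hv : (a l : ℕ) < l := h'
    have hm := hmin ⟨a l, hv.trans l.2⟩ hv
    have : (⟨a l, hv.trans l.2⟩ : Fin L) = l := a.injective (hm.trans (by ext; simp))
    exact hv.ne (congrArg Fin.val this)
  have hd : (θ (a l) : ℝ) < θ i := hθ i (a l) hlt l.2
  refine ⟨a.trans (Equiv.swap (a l) i).toEmbedding, ?_⟩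
  set b := a.trans (Equiv.swap (a l) i).toEmbedding with hb
  have hbl : b l = i := by simp [hb]
  rw [← sub_pos, mean, mean, ← Finset.sum_sub_distrib]
  have hκl : (0 : ℝ) < κ l := hκ_pos l
  by_cases hex : ∃ m, a m = i
  · obtain ⟨m, hm⟩ := hex
    have hlm : l < m := by
      rcases lt_trichotomy l m with h | h | h
      · exact h
      · exact absurd (h ▸ hm) hl
      · have := hmin m h
        rw [hm, hi] at this
        exact absurd (Fin.castLE_injective hLK this) h.ne'
    have hbm : b m = a l := by simp [hb, hm]
    have hz : ∀ n, n ≠ l ∧ n ≠ m → (κ n : ℝ) * θ (b n) - κ n * θ (a n) = 0 := by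
      rintro n ⟨h1, h2⟩
      have : b n = a n := by
        simp only [hb, Function.Embedding.trans_apply, Equiv.coe_toEmbedding]
        exact Equiv.swap_apply_of_ne_of_ne (a.injective.ne h1) (hm ▸ a.injective.ne h2)
      rw [this, sub_self]
    rw [Fintype.sum_eq_add l m hlm.ne hz, hbl, hbm, hm]
    have : (κ m : ℝ) < κ l := hκ hlm
    nlinarith
  · rw [Fintype.sum_eq_single l, hbl]
    · nlinarith
    · intro n hn
      have : b n = a n := by
        simp only [hb, Function.Embedding.trans_apply, Equiv.coe_toEmbedding]
        exact Equiv.swap_apply_of_ne_of_ne (a.injective.ne hn) fun h => hex ⟨n, h⟩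
      rw [this, sub_self]

lemma mean_firstItems (hLK : L ≤ K) (hκ : StrictAnti κ) (hκ_pos : ∀ l, 0 < κ l)
    (hθ : ∀ i j : Fin K, i < j → (i : ℕ) < L → θ j < θ i) :
    mean κ θ (firstItems hLK) = bestMean κ θ := by
  have : Nonempty (Action K L) := ⟨firstItems hLK⟩
  obtain ⟨a, ha⟩ := exists_eq_ciSup_of_finite (f := mean κ θ)
  by_cases h : a = firstItems hLK
  · exact h ▸ ha
  · obtain ⟨b, hb⟩ := exists_mean_lt hLK hκ hκ_pos hθ h
    exact absurd ((mean_le_bestMean κ θ b).trans_eq ha.symm) hb.not_ge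

lemma gap_pos (hLK : L ≤ K) (hκ : StrictAnti κ) (hκ_pos : ∀ l, 0 < κ l)
    (hθ : ∀ i j : Fin K, i < j → (i : ℕ) < L → θ j < θ i) {a : Action K L}
    (ha : a ≠ firstItems hLK) : 0 < gap κ θ a := by
  obtain ⟨b, hb⟩ := exists_mean_lt hLK hκ hκ_pos hθ ha
  exact sub_pos.2 (hb.trans_le (mean_le_bestMean κ θ b))

end Optimal

/-! ### Asymptotics for uniformly efficient algorithms -/

section Asymptotic

variable {κ : Fin L → unitInterval} {π : Algorithm K L}

lemma UniformlyEfficient.tendsto_expectedPlays (hπ : UniformlyEfficient κ π) {θ : Param K}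
    {a : Action K L} (ha : 0 < gap κ θ a) {α : ℝ} (h0 : 0 < α) (h1 : α ≤ 1) :
    Tendsto (fun T : ℕ => expectedPlays κ π θ T a / (T : ℝ) ^ α) atTop (nhds 0) := by
  have h := ((hπ θ α h0 h1).tendsto_div_nhds_zero).div_const (gap κ θ a)
  rw [zero_div] at h
  refine squeeze_zero (fun T => div_nonneg (expectedPlays_nonneg κ π θ T a) (by positivity))
    (fun T => ?_) h
  rw [div_right_comm]
  refine div_le_div_of_nonneg_right ?_ (by positivity)
  rw [le_div_iff₀ ha, mul_comm]
  exact gap_mul_expectedPlays_le κ π θ T a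

/-- If all actions but `a` are suboptimal, then `a` is played in almost all rounds. -/
lemma UniformlyEfficient.tendsto_expectedPlays_div (hπ : UniformlyEfficient κ π) {θ : Param K}
    {a : Action K L} (ha : ∀ b, b ≠ a → 0 < gap κ θ b) :
    Tendsto (fun T : ℕ => expectedPlays κ π θ T a / (T : ℝ)) atTop (nhds 1) := by
  have h : Tendsto (fun T : ℕ => 1 - ∑ b ∈ Finset.univ.erase a,
      expectedPlays κ π θ T b / (T : ℝ)) atTop
      (nhds (1 - ∑ _b ∈ (Finset.univ.erase a : Finset (Action K L)), (0 : ℝ))) := by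
    refine tendsto_const_nhds.sub (tendsto_finsetSum _ fun b hb => ?_)
    simpa using hπ.tendsto_expectedPlays (ha b (Finset.ne_of_mem_erase hb)) one_pos le_rfl
  simp only [Finset.sum_const_zero, sub_zero] at h
  refine h.congr' ?_
  filter_upwards [eventually_gt_atTop 0] with T hT
  have hT' : (T : ℝ) ≠ 0 := by exact_mod_cast hT.ne'
  rw [← Finset.sum_div, eq_div_iff hT', sub_mul, div_mul_cancel₀ _ hT', one_mul,
    ← sum_expectedPlays κ π θ T, ← Finset.add_sum_erase _ _ (Finset.mem_univ a)]
  ring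

/-- The number of plays of `a` is `T - o(T)` under `θ` but `o(T ^ (1 - y))` under `lam`, for every
`y < 1`, and distinguishing the two costs an information of `y log T`. An action that is
uniquely optimal under `θ` and suboptimal under `lam` thus forces an information that is
asymptotically at least `log T`. -/
lemma UniformlyEfficient.eventually_le_info (hπ : UniformlyEfficient κ π) (hκ : ∀ l, 0 < κ l)
    {θ lam : Param K} {a : Action K L} (ha : ∀ b, b ≠ a → 0 < gap κ θ b)
    (ha' : 0 < gap κ lam a) {x : ℝ} (hx : x < 1) :
    ∀ᶠ T : ℕ in atTop,
      x ≤ ∑ b, info κ θ lam b * (expectedPlays κ π θ T b / Real.log T) := by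
  obtain ⟨y, hxy, hy1⟩ := exists_between (max_lt hx one_pos)
  obtain ⟨hxy, hy0⟩ := max_lt_iff.1 hxy
  have hlog : Tendsto (fun T : ℕ => Real.log T) atTop atTop :=
    Real.tendsto_log_atTop.comp tendsto_natCast_atTop_atTop
  -- `1 - y` is the exponent at which uniform efficiency under `lam` is used
  have h1 : Tendsto (fun T : ℕ => y * (expectedPlays κ π θ T a / (T : ℝ))
      - expectedPlays κ π lam T a / (T : ℝ) ^ (1 - y) * (Real.log T)⁻¹) atTop
      (nhds (y * 1 - 0 * 0)) :=
    ((hπ.tendsto_expectedPlays_div ha).const_mul y).sub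
      ((hπ.tendsto_expectedPlays ha' (sub_pos.2 hy1) (by linarith)).mul
        (tendsto_inv_atTop_zero.comp hlog))
  rw [mul_one, mul_zero, sub_zero] at h1
  filter_upwards [h1.eventually (lt_mem_nhds hxy), hlog.eventually_gt_atTop 0,
    eventually_gt_atTop 0] with T hT hl hT0
  have hT' : (0 : ℝ) < T := by exact_mod_cast hT0
  have h2 := mul_expectedPlays_le_info_add π θ hκ lam hT0 a (Real.log T * y)
  rw [← Real.rpow_def_of_pos hT'] at h2
  have h3 : (T : ℝ) ^ y * (expectedPlays κ π lam T a / T)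
      = expectedPlays κ π lam T a / (T : ℝ) ^ (1 - y) := by
    rw [Real.rpow_sub hT', Real.rpow_one]
    field_simp
  rw [h3] at h2
  simp only [← mul_div_assoc, ← Finset.sum_div]
  rw [le_div_iff₀ hl]
  have h4 := mul_le_mul_of_nonneg_right hT.le hl.le
  rw [sub_mul, mul_assoc (_ / _) (_)⁻¹, inv_mul_cancel₀ hl.ne', mul_one] at h4
  linear_combination h2 + h4

end Asymptotic

lemma mean_congr_firstItems (hLK : L ≤ K) (κ : Fin L → unitInterval) {θ lam : Param K}
    (h : ∀ k : Fin K, (k : ℕ) < L → lam k = θ k) :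
    mean κ lam (firstItems hLK) = mean κ θ (firstItems hLK) :=
  Finset.sum_congr rfl fun l _ => by rw [h (firstItems hLK l) (Fin.val_castLE hLK l ▸ l.2)]

lemma info_firstItems (hLK : L ≤ K) {κ : Fin L → unitInterval} (hκ : ∀ l, 0 < κ l)
    {θ lam : Param K} (h : ∀ k : Fin K, (k : ℕ) < L → lam k = θ k) :
    info κ θ lam (firstItems hLK) = 0 := by
  rw [info]
  refine Finset.sum_eq_zero fun l _ => ?_
  have := h (firstItems hLK l) (Fin.val_castLE hLK l ▸ l.2)
  simp [localInfo, this, expect, div_self (toReal_censored_pos (hκ l) _ _).ne']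

end PBM

end

/-- The arms are ordered so that the optimal action is the list of the first `L` arms:
`θ_1 > ⋯ > θ_L > θ_k` for `k > L` (numbering from `1`), and `1 ≥ κ_1 > ⋯ > κ_L > 0`. -/
theorem theorem1 (K L : ℕ) (hLK : L ≤ K)
    (κ : Fin L → unitInterval) (hκ : StrictAnti κ) (hκ_pos : ∀ l, 0 < κ l)
    (θ : PBM.Param K) (hθ : ∀ i j : Fin K, i < j → (i : ℕ) < L → θ j < θ i)
    (π : PBM.Algorithm K L) (hπ : PBM.UniformlyEfficient κ π) :
    PBM.lowerBound κ θ ≤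
      Filter.liminf
        (fun T : ℕ => ((PBM.expectedRegret κ π θ T / Real.log T : ℝ) : EReal))
        Filter.atTop := by
  open PBM in
  by_contra! hlt
  obtain ⟨M, hM1, hM2⟩ := EReal.lt_iff_exists_real_btwn.1 hlt
  have hfreq : ∃ᶠ T : ℕ in atTop, expectedRegret κ π θ T / Real.log T < M :=
    (frequently_lt_of_liminf_lt (by isBoundedDefault) hM1).mono fun T hT =>
      EReal.coe_lt_coe_iff.1 hT
  have hgap : ∀ a, a ≠ firstItems hLK → 0 < gap κ θ a := fun a => gap_pos hLK hκ hκ_pos hθ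
  have hgap0 : gap κ θ (firstItems hLK) = 0 :=
    sub_eq_zero.2 (mean_firstItems hLK hκ hκ_pos hθ).symm
  -- The optimal action carries neither gap nor information, and its number of plays is not
  -- `O(log T)`: its coordinate is replaced by `0`.
  let c : ℕ → Action K L → ℝ := fun T a =>
    if a = firstItems hLK then 0 else expectedPlays κ π θ T a / Real.log T
  have hc (w : Action K L → ℝ) (hw : w (firstItems hLK) = 0) (T : ℕ) :
      ∑ a, w a * c T a = ∑ a, w a * (expectedPlays κ π θ T a / Real.log T) := by
    refine Finset.sum_congr rfl fun a _ => ?_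
    by_cases ha : a = firstItems hLK
    · rw [ha, hw, zero_mul, zero_mul]
    · simp only [c, if_neg ha]
  have hcR (T : ℕ) : ∑ a, gap κ θ a * c T a = expectedRegret κ π θ T / Real.log T := by
    rw [hc _ hgap0, expectedRegret_eq, Finset.sum_div]
    simp only [mul_div_assoc]
  have hc0 (T : ℕ) (a) : 0 ≤ c T a := by
    simp only [c]
    split_ifs
    · exact le_rfl
    · exact div_nonneg (expectedPlays_nonneg κ π θ T a) (Real.log_natCast_nonneg T)
  have : (atTop ⊓ 𝓟 {T : ℕ | expectedRegret κ π θ T / Real.log T < M}).NeBot :=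
    frequently_mem_iff_neBot.1 hfreq
  let U : Ultrafilter ℕ :=
    Ultrafilter.of (atTop ⊓ 𝓟 {T : ℕ | expectedRegret κ π θ T / Real.log T < M})
  have hU : (U : Filter ℕ) ≤ atTop := (Ultrafilter.of_le _).trans inf_le_left
  have hUM : ∀ᶠ T in (U : Filter ℕ), expectedRegret κ π θ T / Real.log T < M :=
    (Ultrafilter.of_le _).trans inf_le_right (mem_principal_self _)
  have hUc : ∀ᶠ T in (U : Filter ℕ), c T ∈ Set.Icc 0 fun a => M / gap κ θ a := by
    filter_upwards [hUM] with T hT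
    refine ⟨hc0 T, fun a => ?_⟩
    by_cases ha : a = firstItems hLK
    · -- here `M / gap κ θ a = M / 0 = 0`
      simp [c, ha, hgap0]
    · rw [le_div_iff₀ (hgap a ha), mul_comm]
      refine le_trans ?_ ((hcR T).trans_lt hT).le
      exact Finset.single_le_sum (f := fun a => gap κ θ a * c T a)
        (fun b _ => mul_nonneg (gap_nonneg κ θ b) (hc0 T b)) (Finset.mem_univ a)
  obtain ⟨d, -, hd⟩ := isCompact_Icc.ultrafilter_le_nhds (U.map c) (le_principal_iff.2 hUc)
  have hd : Tendsto c U (nhds d) := hd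
  have hlim (w : Action K L → ℝ) : Tendsto (fun T => ∑ a, w a * c T a) U (nhds (∑ a, w a * d a)) :=
    tendsto_finsetSum _ fun a _ => (tendsto_pi_nhds.1 hd a).const_mul _
  have hfeas : d ∈ feasible κ θ := by
    refine ⟨fun a => ge_of_tendsto' (tendsto_pi_nhds.1 hd a) fun T => hc0 T a, ?_⟩
    refine le_iInf₂ fun lam hlam => ?_
    refine EReal.coe_le_coe_iff.2 (le_of_forall_lt_imp_le_of_dense fun x hx => ?_)
    have hgap' : 0 < gap κ lam (firstItems hLK) := by
      rw [gap, mean_congr_firstItems hLK κ hlam.1, mean_firstItems hLK hκ hκ_pos hθ]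
      exact sub_pos.2 hlam.2
    refine ge_of_tendsto (hlim _) ?_
    filter_upwards [hU (hπ.eventually_le_info hκ_pos hgap hgap' hx)] with T hT
    rwa [hc _ (info_firstItems hLK hκ_pos hlam.1)]
  have hle : ∑ a, gap κ θ a * d a ≤ M :=
    le_of_tendsto (hlim _) (hUM.mono fun T hT => ((hcR T).trans_lt hT).le)
  exact hM2.not_ge ((iInf₂_le d hfeas).trans (EReal.coe_le_coe_iff.2 hle))
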